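/- Let $K$ be an algebraically closed field. An algebraic group over $K$ is a group object in the category of $K$-schemes whose underlying scheme is a reduced $K$-scheme of finite type; it is identified with its group of $K$-points. For an algebraic group $V$ and a finite set $E$, an algebraic subgroup of $V^E$ is a subgroup of $V^E$ which is closed in the Zariski topology of the $K$-variety $V^E$. Homomorphisms of algebraic groups are group homomorphisms induced by morphisms of $K$-schemes. Let $G$ be a polycyclic-by-finite group, i.e. a group with a finite series of subgroups $\{1\}=G_0\subset G_1\subset\dots\subset G_n=G$ such that each $G_{k-1}$ is normal in $G_k$ and $G_k/G_{k-1}$ is cyclic or finite. For a set $A$, the group $G$ acts on $A^G$ by $(gx)(h)=x(g^{-1}h)$. Let $U$ and $V$ be algebraic groups over $K$. A subset $\Sigma\subset V^G$ is an algebraic group subshift of $V^G$ if it is $G$-invariant, closed in the prodiscrete topology (the product of the discrete topologies), and if for every finite $E\subset G$ its restriction $\Sigma_E=\{x|_E : x\in\Sigma\}$ is an algebraic subgroup of $V^E$. A subset $\Sigma\subset V^G$ is an algebraic group subshift of finite type of $V^G$ if there are a finite set $D\subset G$ and an algebraic subgroup $W\subset V^D$ with $\Sigma=\{x\in V^G :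 (g^{-1}x)|_D\in W \text{ for all } g\in G\}$. A map $\tau\colon U^G\to V^G$ is an algebraic group cellular automaton if there are a finite set $M\subset G$ and a homomorphism of algebraic groups $\mu\colon U^M\to V$ with $\tau(x)(g)=\mu((g^{-1}x)|_M)$ for all $x\in U^G$ and $g\in G$. Theorem. Let $\Sigma_1$ and $\Sigma_2$ be algebraic group subshifts of $U^G$ and $V^G$ respectively, and let $\tau\colon U^G\to V^G$ be an algebraic group cellular automaton. Then $\tau^{-1}(\Sigma_2)$ is an algebraic group subshift of finite type of $U^G$, and $\tau(\Sigma_1)$ is an algebraic group subshift of finite type of $V^G$. -/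

import Mathlib

open CategoryTheory AlgebraicGeometry MonoidalCategory
open scoped MonObj

universe u v

namespace AlgShift

/-- `G` is polycyclic-by-finite: it has a finite series of subgroups
`1 = S 0 ≤ S 1 ≤ ⋯ ≤ S n = G`, each normal in the next one, such that every factor
`S (k + 1) / S k` is cyclic or finite. -/
def IsPolycyclicByFinite (G : Type v) [Group G] : Prop :=
  ∃ (n : ℕ) (S : ℕ → Subgroup G), S 0 = ⊥ ∧ S n = ⊤ ∧
    ∀ k < n, S k ≤ S (k + 1) ∧
      ∃ _ : ((S k).subgroupOf (S (k + 1))).Normal,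
        IsCyclic (S (k + 1) ⧸ (S k).subgroupOf (S (k + 1))) ∨
          Finite (S (k + 1) ⧸ (S k).subgroupOf (S (k + 1)))

section Symbolic

variable {G : Type v} [Group G] {A B : Type u}

/-- The shift action of `G` on configurations: `(g x)(h) = x (g⁻¹ h)`. -/
def shift (g : G) (x : G → A) : G → A := fun h => x (g⁻¹ * h)

/-- The restrictions to `E` of the configurations in `X`. -/
def restrictTo (X : Set (G → A)) (E : Finset G) : Set (E → A) :=
  (fun x : G → A => E.restrict x) '' X

/-- Closedness in the prodiscrete topology, i.e. the product of the discrete topologies. -/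
def IsProdiscreteClosed (X : Set (G → A)) : Prop :=
  @IsClosed (G → A) (@Pi.topologicalSpace G (fun _ => A) fun _ => ⊥) X

/-- The subshift with defining window `D` and allowed patterns `P`. -/
def subshiftOf (D : Finset G) (P : Set (D → A)) : Set (G → A) :=
  {x | ∀ g : G, D.restrict (shift g⁻¹ x) ∈ P}

/-- `f : B^M → A` is a local defining map of `τ : B^G → A^G` for the memory set `M`. -/
def IsLocalDefiningMap (τ : (G → B) → (G → A)) (M : Finset G) (f : (M → B) → A) : Prop :=
  ∀ (x : G → B) (g : G), τ x g = f (M.restrict (shift g⁻¹ x))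

end Symbolic

section Algebraic

variable {K : Type u} [Field K]

/-- An algebraic variety over `K`: a reduced `K`-scheme of finite type. -/
structure IsAlgVariety (V : Over (Spec (.of K))) : Prop where
  reduced : IsReduced V.left
  locallyOfFiniteType : LocallyOfFiniteType V.hom
  quasiCompact : QuasiCompact V.hom

/-- The `K`-points of a `K`-scheme. When `V` is a group object, these form a group. -/
abbrev Points (V : Over (Spec (.of K))) : Type u := 𝟙_ (Over (Spec (.of K))) ⟶ V

/-- The point of the underlying topological space of `V` given by a `K`-point. -/
noncomputable def Points.pt {V : Over (Spec (.of K))} (p : Points V) : V.left :=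
  p.left (IsLocalRing.closedPoint K)

/-- The finite power `V^E` as a `K`-scheme. -/
noncomputable abbrev power (V : Over (Spec (.of K))) (E : Type v) [Finite E] :
    Over (Spec (.of K)) := ∏ᶜ fun _ : E => V

/-- The identification `V(K)^E = V^E(K)`. -/
noncomputable abbrev toPower {V : Over (Spec (.of K))} {E : Type v} [Finite E]
    (x : E → Points V) : Points (power V E) := Limits.Pi.lift x

/-- `W ⊆ V(K)^E` is Zariski closed: it is the set of `K`-points of a closed subset of the
`K`-scheme `V^E`. -/
def IsZariskiClosed {V : Over (Spec (.of K))} {E : Type v} [Finite E]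
    (W : Set (E → Points V)) : Prop :=
  ∃ Z : Set (power V E).left, IsClosed Z ∧ W = {x | (toPower x).pt ∈ Z}

/-- An algebraic subgroup of `V^E`: an abstract subgroup that is Zariski closed. -/
def IsAlgSubgroup {V : Over (Spec (.of K))} [GrpObj V] {E : Type v} [Finite E]
    (W : Set (E → Points V)) : Prop :=
  (∃ H : Subgroup (E → Points V), (H : Set (E → Points V)) = W) ∧ IsZariskiClosed W

/-- A homomorphism of algebraic groups `U^M → V`, on `K`-points: a group homomorphism which is
induced by a morphism of `K`-schemes. -/
def IsAlgHom {U V : Over (Spec (.of K))} [GrpObj U] [GrpObj V] {M : Type v} [Finite M]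
    (f : (M → Points U) →* Points V) : Prop :=
  ∃ φ : power U M ⟶ V, ∀ x : M → Points U, f x = toPower x ≫ φ

variable {G : Type v} [Group G]

/-- Algebraic group subshifts of `V^G`. -/
structure IsAlgGroupSubshift (V : Over (Spec (.of K))) [GrpObj V]
    (X : Set (G → Points V)) : Prop where
  shift_mem : ∀ (g : G), ∀ x ∈ X, shift g x ∈ X
  closed : IsProdiscreteClosed X
  restrict : ∀ E : Finset G, IsAlgSubgroup (restrictTo X E)

/-- Algebraic group subshifts of finite type of `V^G`. -/
def IsAlgGroupSFT (V : Over (Spec (.of K))) [GrpObj V] (X : Set (G → Points V)) : Prop :=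
  ∃ (D : Finset G) (W : Set (D → Points V)), IsAlgSubgroup W ∧ X = subshiftOf D W

/-- Algebraic group cellular automata `U^G → V^G`. -/
def IsAlgGroupCA (U V : Over (Spec (.of K))) [GrpObj U] [GrpObj V]
    (τ : (G → Points U) → (G → Points V)) : Prop :=
  ∃ (M : Finset G) (f : (M → Points U) →* Points V), IsAlgHom f ∧ IsLocalDefiningMap τ M f

end Algebraic

end AlgShift

/-! Everything reduces to two facts about algebraic groups over an algebraically closed field:
homomorphic images of closed subgroups are closed (`IsRegular.isClosed_map`, from Chevalley's
theorem), and closed sets satisfy the descending chain condition. They make the subgroups of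
`V(K)^G` cut out by finitely many coordinates an `IsCylinderFamily`, and the rest of the argument
mostly uses only that. A cylinder family has a compactness property
(`IsCylinderFamily.sInter_nonempty`): cosets with the finite intersection property have a common
point. Hence projections of closed subgroups, and images under cellular automata, are closed. If `G`
is polycyclic-by-finite, closed invariant subgroups satisfy the descending chain condition
(`IsPolycyclicByFinite.hasDCC_top`). This goes up the series of `G`; a cyclic factor is treated as
in Hilbert's basis theorem, with "leading parts" in place of leading coefficients. The subshifts of
finite type approximating a given subshift then stabilise, so every algebraic group subshift is of
finite type. Finite type passes to preimages directly, and an image inherits the hypotheses of this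
result. -/

/-! ### Topology: closed subgroups and constructible sets. -/

/-- Multiplication is only assumed separately continuous, since the Zariski topology of a power is
not the product topology. -/
theorem isClosed_subgroup_of_isOpen_inter_closure_subset {Γ : Type*} [Group Γ] [TopologicalSpace Γ]
    (hl : ∀ a : Γ, Continuous fun x => a * x) (hr : ∀ a : Γ, Continuous fun x => x * a)
    (hi : Continuous fun x : Γ => x⁻¹) (H : Subgroup Γ) {O : Set Γ} (hO : IsOpen O)
    (hne : (O ∩ closure (H : Set Γ)).Nonempty) (hsub : O ∩ closure (H : Set Γ) ⊆ H) :
    IsClosed (H : Set Γ) := by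
  have hmul : ∀ a ∈ H, ∀ y ∈ closure (H : Set Γ), a * y ∈ closure (H : Set Γ) := fun a ha y hy =>
    map_mem_closure (hl a) hy fun z hz => H.mul_mem ha hz
  have hmul' : ∀ y ∈ closure (H : Set Γ), ∀ a ∈ H, y * a ∈ closure (H : Set Γ) := fun y hy a ha =>
    map_mem_closure (f := fun x => x * a) (hr a) hy fun z hz => H.mul_mem hz ha
  have hinv : ∀ y ∈ closure (H : Set Γ), y⁻¹ ∈ closure (H : Set Γ) := fun y hy =>
    map_mem_closure hi hy fun z hz => H.inv_mem hz
  obtain ⟨h, hhO, hhc⟩ := hne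
  have hh : h ∈ H := hsub ⟨hhO, hhc⟩
  refine isClosed_of_closure_subset fun y hy => ?_
  -- This open set contains `y`, because `h * y⁻¹ * y = h`; so it meets `H`.
  have hopen : IsOpen ((fun z => h * y⁻¹ * z) ⁻¹' O) := hO.preimage (hl _)
  obtain ⟨z, hzO, hz⟩ := mem_closure_iff.mp hy _ hopen (by simpa using hhO)
  have hz : z ∈ H := hz
  have key : h * y⁻¹ * z ∈ H :=
    hsub ⟨hzO, hmul' _ (hmul h hh _ (hinv y hy)) z hz⟩
  have := H.mul_mem (H.mul_mem hz (H.inv_mem key)) hh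
  simpa [mul_assoc] using this

/-- Quantifying over every `F` drives the induction: for a union, the second hypothesis is applied
to the piece `O₁ ∩ F` given by the first. -/
theorem Topology.IsConstructible.exists_isOpen_inter_subset {X Y : Type*} [TopologicalSpace X]
    [TopologicalSpace Y] {i : Y → X} (hi : Continuous i) {T : Set X} (hT : IsConstructible T) :
    ∀ F : Set Y, F.Nonempty → ∃ O : Set Y, IsOpen O ∧ (O ∩ F).Nonempty ∧
      (O ∩ F ⊆ i ⁻¹' T ∨ O ∩ F ⊆ (i ⁻¹' T)ᶜ) := by
  induction hT using IsConstructible.empty_union_induction with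
  | open_retrocompact W hW _ =>
    intro F hF
    by_cases hne : (i ⁻¹' W ∩ F).Nonempty
    · exact ⟨_, hW.preimage hi, hne, .inl Set.inter_subset_left⟩
    · refine ⟨Set.univ, isOpen_univ, by simpa using hF, .inr ?_⟩
      rintro y ⟨-, hy⟩ hyW
      exact hne ⟨y, hyW, hy⟩
  | union s _ t _ ihs iht =>
    intro F hF
    obtain ⟨O₁, hO₁, hne₁, h₁⟩ := ihs F hF
    rcases h₁ with h₁ | h₁
    · exact ⟨O₁, hO₁, hne₁, .inl (h₁.trans (Set.preimage_mono Set.subset_union_left))⟩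
    obtain ⟨O₂, hO₂, hne₂, h₂⟩ := iht (O₁ ∩ F) hne₁
    refine ⟨O₂ ∩ O₁, hO₂.inter hO₁, by rwa [Set.inter_assoc], ?_⟩
    rw [Set.inter_assoc]
    rcases h₂ with h₂ | h₂
    · exact .inl (h₂.trans (Set.preimage_mono Set.subset_union_right))
    · refine .inr fun y hy hys => ?_
      rcases hys with hys | hys
      · exact h₁ hy.2 hys
      · exact h₂ hy hys
  | compl s _ ih =>
    intro F hF
    obtain ⟨O, hO, hne, h⟩ := ih F hF
    exact ⟨O, hO, hne, by simpa [or_comm] using h⟩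

/-! ### Schemes of finite type and their `K`-points. -/

namespace AlgShift

variable {K : Type u} [Field K]

/-- The property of a `K`-scheme of being of finite type. -/
def IsFiniteType : ObjectProperty (Over (Spec (.of K))) :=
  fun V => LocallyOfFiniteType V.hom ∧ QuasiCompact V.hom

theorem IsAlgVariety.isFiniteType {V : Over (Spec (.of K))} (h : IsAlgVariety V) :
    IsFiniteType V := ⟨h.locallyOfFiniteType, h.quasiCompact⟩

theorem IsFiniteType.of_iso {X Y : Over (Spec (.of K))} (e : X ≅ Y) (h : IsFiniteType X) :
    IsFiniteType Y := by
  have h1 := h.1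
  have h2 := h.2
  have : IsIso e.inv.left := inferInstanceAs (IsIso ((Over.forget _).map e.inv))
  have hY : e.inv.left ≫ X.hom = Y.hom := Over.w e.inv
  have h3 : LocallyOfFiniteType (e.inv.left ≫ X.hom) := inferInstance
  have h4 : QuasiCompact (e.inv.left ≫ X.hom) := inferInstance
  rw [hY] at h3 h4
  exact ⟨h3, h4⟩

open Limits in
instance : (IsFiniteType (K := K)).IsClosedUnderLimitsOfShape (Discrete PEmpty.{1}) where
  limitsOfShape_le := by
    rintro X p
    let t : IsTerminal X := (ObjectProperty.limitsOfShape_isEmpty_iff _ _ _ |>.mp p).some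
    refine IsFiniteType.of_iso (Over.mkIdTerminal.uniqueUpToIso t) ?_
    exact ⟨inferInstanceAs (LocallyOfFiniteType (𝟙 _)), inferInstanceAs (QuasiCompact (𝟙 _))⟩

open Limits in
instance : (IsFiniteType (K := K)).IsClosedUnderBinaryProducts where
  limitsOfShape_le := by
    rintro X ⟨p⟩
    have h1 := p.prop_diag_obj ⟨.left⟩
    have h2 := p.prop_diag_obj ⟨.right⟩
    let e : p.diag ≅ pair (p.diag.obj ⟨.left⟩) (p.diag.obj ⟨.right⟩) := diagramIsoPair _
    refine IsFiniteType.of_iso (X := p.diag.obj ⟨.left⟩ ⊗ p.diag.obj ⟨.right⟩)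
      (IsLimit.conePointsIsoOfNatIso
        (CartesianMonoidalCategory.tensorProductIsBinaryProduct _ _) p.isLimit e.symm) ?_
    have := h1.1
    have := h1.2
    have := h2.1
    have := h2.2
    refine ⟨?_, ?_⟩ <;> rw [Over.tensorObj_hom] <;> infer_instance

instance : (IsFiniteType (K := K)).IsClosedUnderFiniteProducts :=
  ObjectProperty.IsClosedUnderFiniteProducts.mk'

theorem IsFiniteType.power {V : Over (Spec (.of K))} (h : IsFiniteType V) (E : Type v) [Finite E] :
    IsFiniteType (power V E) :=
  ObjectProperty.prop_product _ fun _ => h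

theorem IsFiniteType.isNoetherian {V : Over (Spec (.of K))} (h : IsFiniteType V) :
    IsNoetherian V.left := by
  have := h.1
  have := h.2
  have : IsLocallyNoetherian V.left := LocallyOfFiniteType.isLocallyNoetherian V.hom
  have : CompactSpace V.left := (quasiCompact_iff_compactSpace (f := V.hom)).mp inferInstance
  exact {}

theorem Points.pt_comp {U V : Over (Spec (.of K))} (p : Points U) (φ : U ⟶ V) :
    Points.pt (p ≫ φ) = φ.left p.pt := by
  simp [Points.pt]
  rfl

section AlgClosed

variable [IsAlgClosed K]

theorem Points.pt_injective {V : Over (Spec (.of K))} (h : IsFiniteType V) :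
    Function.Injective (Points.pt (V := V)) := by
  intro p q hpq
  have := h.1
  exact Over.OverMorphism.ext
    (ext_of_apply_closedPoint_eq V.hom (Over.w p) (Over.w q) hpq)

theorem Points.isClosed_pt {V : Over (Spec (.of K))} (h : IsFiniteType V) (p : Points V) :
    IsClosed {p.pt} := by
  have := h.1
  exact (pointEquivClosedPoint V.hom ⟨p.left, Over.w p⟩).2

theorem Points.exists_pt_eq {V : Over (Spec (.of K))} (h : IsFiniteType V) {z : V.left}
    (hz : IsClosed {z}) : ∃ p : Points V, p.pt = z := by
  have := h.1
  exact ⟨Over.homMk (pointOfClosedPoint V.hom z hz) (pointOfClosedPoint_comp V.hom z hz),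
    pointOfClosedPoint_apply V.hom z hz _⟩

/-- The scheme is Jacobson, so a nonempty closed set has a closed point, which is a `K`-point as `K`
is algebraically closed. -/
theorem Points.exists_mem_of_isClosed {V : Over (Spec (.of K))} (h : IsFiniteType V)
    {Z : Set V.left} (hZ : IsClosed Z) (hne : Z.Nonempty) : ∃ p : Points V, p.pt ∈ Z := by
  have := h.1
  have : JacobsonSpace V.left := LocallyOfFiniteType.jacobsonSpace (Y := Spec _) V.hom
  obtain ⟨z, hz, hz'⟩ := nonempty_inter_closedPoints hne hZ.isLocallyClosed
  obtain ⟨p, rfl⟩ := Points.exists_pt_eq h hz'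
  exact ⟨p, hz⟩

/-- A morphism of `K`-schemes of finite type maps the `K`-points of a closed set onto the
`K`-points of a constructible set. -/
theorem exists_isConstructible_image {U V : Over (Spec (.of K))} (hU : IsFiniteType U)
    (hV : IsFiniteType V) (φ : U ⟶ V) {Z : Set U.left} (hZ : IsClosed Z) :
    ∃ T : Set V.left, Topology.IsConstructible T ∧
      ∀ q : Points V, q.pt ∈ T ↔ ∃ p : Points U, p.pt ∈ Z ∧ p ≫ φ = q := by
  have := hU.1
  have := hV.1
  have := hU.isNoetherian
  have := hV.isNoetherian
  have : LocallyOfFiniteType φ.left :=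
    have : LocallyOfFiniteType (φ.left ≫ V.hom) := by rw [Over.w]; infer_instance
    locallyOfFiniteType_of_comp _ V.hom
  have hZc : Topology.IsConstructible Z := by
    rw [← Topology.isConstructible_compl]
    exact (TopologicalSpace.NoetherianSpace.isCompact _).isConstructible hZ.isOpen_compl
  refine ⟨φ.left '' Z, φ.left.isConstructible_image hZc, fun q => ⟨?_, ?_⟩⟩
  · rintro ⟨z, hz, hzq⟩
    -- The fibre over the closed point `q` is closed, so its intersection with `Z` contains a
    -- `K`-point.
    obtain ⟨p, hp⟩ := Points.exists_mem_of_isClosed hU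
      (hZ.inter ((Points.isClosed_pt hV q).preimage φ.left.continuous)) ⟨z, hz, hzq⟩
    exact ⟨p, hp.1, Points.pt_injective hV ((Points.pt_comp p φ).trans hp.2)⟩
  · rintro ⟨p, hp, rfl⟩
    exact ⟨_, hp, (Points.pt_comp p φ).symm⟩

end AlgClosed

/-! ### Zariski topology on powers, regular maps, closed images of homomorphisms. -/

/-- The Zariski topology on `V(K)^E`. -/
noncomputable abbrev zariski (V : Over (Spec (.of K))) (E : Type v) [Finite E] :
    TopologicalSpace (E → Points V) :=
  .induced (fun x => (toPower x).pt) inferInstance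

attribute [local instance] zariski

variable {U V X : Over (Spec (.of K))} {E E' E'' : Type v} [Finite E] [Finite E'] [Finite E'']

theorem isZariskiClosed_iff {W : Set (E → Points V)} : IsZariskiClosed W ↔ IsClosed W := by
  rw [isClosed_induced_iff]
  simp only [IsZariskiClosed, Set.preimage, eq_comm]

theorem IsFiniteType.noetherianSpace (h : IsFiniteType V) :
    TopologicalSpace.NoetherianSpace (E → Points V) := by
  have := (h.power E).isNoetherian
  exact Topology.IsInducing.noetherianSpace (i := fun x : E → Points V => (toPower x).pt) ⟨rfl⟩

omit [Finite E'] in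
/-- A map `U(K)^E → V(K)^E'` whose components are induced by morphisms of `K`-schemes. -/
def IsRegular (F : (E → Points U) → (E' → Points V)) : Prop :=
  ∀ e, ∃ φ : power U E ⟶ V, ∀ x, F x e = toPower x ≫ φ

theorem toPower_π (x : E → Points V) (e : E) :
    toPower x ≫ Limits.Pi.π (fun _ : E => V) e = x e := by
  simp [toPower]

theorem toPower_injective : Function.Injective (toPower (V := V) (E := E)) := fun x y h => by
  funext e
  rw [← toPower_π x, h, toPower_π]

theorem exists_toPower_eq (p : Points (power V E)) : ∃ x : E → Points V, toPower x = p :=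
  ⟨fun e => p ≫ Limits.Pi.π _ e, by
    apply Limits.Pi.hom_ext
    intro e
    exact toPower_π _ e⟩

theorem IsRegular.exists_hom {F : (E → Points U) → (E' → Points V)} (hF : IsRegular F) :
    ∃ φ : power U E ⟶ power V E', ∀ x, toPower (F x) = toPower x ≫ φ := by
  choose φ hφ using hF
  refine ⟨Limits.Pi.lift φ, fun x => Limits.Pi.hom_ext _ _ fun e => ?_⟩
  rw [toPower_π, Category.assoc, Limits.Pi.lift_π, hφ]

theorem IsRegular.continuous {F : (E → Points U) → (E' → Points V)} (hF : IsRegular F) :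
    Continuous F := by
  obtain ⟨φ, hφ⟩ := hF.exists_hom
  rw [continuous_induced_rng]
  have : (fun x : E' → Points V => (toPower x).pt) ∘ F =
      φ.left ∘ fun x : E → Points U => (toPower x).pt := by
    funext x
    simp [hφ, Points.pt_comp]
  rw [this]
  exact φ.left.continuous.comp continuous_induced_dom

omit [Finite E''] in
theorem IsRegular.comp {F : (E' → Points V) → (E'' → Points X)}
    {F' : (E → Points U) → (E' → Points V)} (hF : IsRegular F) (hF' : IsRegular F') :
    IsRegular (F ∘ F') := by
  intro e
  obtain ⟨φ, hφ⟩ := hF e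
  obtain ⟨ψ, hψ⟩ := hF'.exists_hom
  exact ⟨ψ ≫ φ, fun x => by simp [hφ, hψ]⟩

omit [Finite E'] in
theorem isRegular_reindex (r : E' → E) : IsRegular fun (x : E → Points V) e => x (r e) :=
  fun e => ⟨Limits.Pi.π _ (r e), fun x => (toPower_π x _).symm⟩

section Group

variable [GrpObj U] [GrpObj V]

theorem isRegular_const_mul (a : E → Points V) : IsRegular fun x => a * x := fun e =>
  ⟨(CartesianMonoidalCategory.toUnit _ ≫ a e) * Limits.Pi.π _ e, fun x => by
    rw [MonObj.comp_mul, toPower_π, ← Category.assoc,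
      CartesianMonoidalCategory.toUnit_unique (toPower x ≫ _) (𝟙 _), Category.id_comp]
    rfl⟩

theorem isRegular_mul_const (a : E → Points V) : IsRegular fun x => x * a := fun e =>
  ⟨Limits.Pi.π _ e * (CartesianMonoidalCategory.toUnit _ ≫ a e), fun x => by
    rw [MonObj.comp_mul, toPower_π, ← Category.assoc,
      CartesianMonoidalCategory.toUnit_unique (toPower x ≫ _) (𝟙 _), Category.id_comp]
    rfl⟩

theorem isRegular_inv : IsRegular fun x : E → Points V => x⁻¹ := fun e =>
  ⟨Limits.Pi.π _ e ≫ ι, fun x => by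
    rw [← Category.assoc, toPower_π]
    rfl⟩

variable [IsAlgClosed K]

omit [GrpObj V] in
theorem IsFiniteType.isClosed_singleton (h : IsFiniteType V) (x : E → Points V) :
    IsClosed {x} := by
  refine isClosed_induced_iff.mpr ⟨_, Points.isClosed_pt (h.power E) (toPower x), ?_⟩
  ext y
  simp only [Set.mem_preimage, Set.mem_singleton_iff]
  exact ⟨fun hy => toPower_injective (Points.pt_injective (h.power E) hy), fun hy => hy ▸ rfl⟩

/-- The image is constructible, so some open set meets its closure inside the image or inside the
complement. Density of the image in its closure excludes the complement. -/
theorem IsRegular.isClosed_map (hU : IsFiniteType U) (hV : IsFiniteType V)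
    {f : (E → Points U) →* (E' → Points V)} (hf : IsRegular f) {H : Subgroup (E → Points U)}
    (hH : IsClosed (H : Set (E → Points U))) : IsClosed (H.map f : Set (E' → Points V)) := by
  obtain ⟨φ, hφ⟩ := hf.exists_hom
  obtain ⟨Z, hZ, hZH⟩ := isClosed_induced_iff.mp hH
  obtain ⟨T, hT, hTφ⟩ := exists_isConstructible_image (hU.power E) (hV.power E') φ hZ
  have hpre : (fun x : E' → Points V => (toPower x).pt) ⁻¹' T = (H.map f : Set _) := by
    ext y
    rw [Set.mem_preimage, hTφ]
    simp only [SetLike.mem_coe, Subgroup.mem_map]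
    constructor
    · rintro ⟨p, hp, hpy⟩
      obtain ⟨x, rfl⟩ := exists_toPower_eq p
      refine ⟨x, by rw [← SetLike.mem_coe, ← hZH]; exact hp, toPower_injective ?_⟩
      rw [hφ, hpy]
    · rintro ⟨x, hx, rfl⟩
      rw [← SetLike.mem_coe, ← hZH] at hx
      exact ⟨_, hx, (hφ x).symm⟩
  obtain ⟨O, hO, hne, hsub⟩ := hT.exists_isOpen_inter_subset
    (i := fun x : E' → Points V => (toPower x).pt) continuous_induced_dom
    (closure (H.map f : Set (E' → Points V))) ⟨1, subset_closure (one_mem _)⟩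
  rw [hpre] at hsub
  refine isClosed_subgroup_of_isOpen_inter_closure_subset
    (fun a => (isRegular_const_mul a).continuous) (fun a => (isRegular_mul_const a).continuous)
    isRegular_inv.continuous _ hO hne (hsub.resolve_right fun h => ?_)
  obtain ⟨y, hy, hyc⟩ := hne
  obtain ⟨z, hzO, hz⟩ := mem_closure_iff.mp hyc O hO hy
  exact h ⟨hzO, subset_closure hz⟩ hz

end Group

theorem exists_minimal_of_isWF {α : Type*} [PartialOrder α] {S T : Set α} (hS : S.IsWF)
    (hTS : T ⊆ S) (hT : T.Nonempty) : ∃ m, Minimal (· ∈ T) m :=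
  ⟨_, (hS.mono hTS).min_mem hT, fun _ hy hle =>
    (eq_or_lt_of_le hle).elim (fun h => h.ge) fun h => absurd h ((hS.mono hTS).not_lt_min hT hy)⟩

/-! ### Cylinder families and compactness of their cosets. -/

section Cylinder

variable {I A : Type*} [Group A]

/-- The configurations that are trivial on `s`. -/
def vanishing (s : Set I) : Subgroup (I → A) where
  carrier := {x | ∀ i ∈ s, x i = 1}
  mul_mem' hx hy i hi := by simp [hx i hi, hy i hi]
  one_mem' _ _ := rfl
  inv_mem' hx i hi := by simp [hx i hi]

theorem mem_vanishing {s : Set I} {x : I → A} : x ∈ vanishing s ↔ ∀ i ∈ s, x i = 1 := Iff.rfl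

theorem vanishing_anti {s t : Set I} (h : s ⊆ t) : (vanishing t : Subgroup (I → A)) ≤ vanishing s :=
  fun _ hx i hi => hx i (h hi)

/-- The configurations that agree on `s` with an element of `X`. -/
def saturate (s : Set I) (X : Subgroup (I → A)) : Subgroup (I → A) where
  carrier := {x | ∃ y ∈ X, ∀ i ∈ s, x i = y i}
  mul_mem' := by
    rintro _ _ ⟨y, hy, h⟩ ⟨y', hy', h'⟩
    exact ⟨y * y', X.mul_mem hy hy', fun i hi => by simp [h i hi, h' i hi]⟩
  one_mem' := ⟨1, X.one_mem, fun _ _ => rfl⟩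
  inv_mem' := by
    rintro _ ⟨y, hy, h⟩
    exact ⟨y⁻¹, X.inv_mem hy, fun i hi => by simp [h i hi]⟩

theorem le_saturate (s : Set I) (X : Subgroup (I → A)) : X ≤ saturate s X :=
  fun x hx => ⟨x, hx, fun _ _ => rfl⟩

theorem vanishing_le_saturate (s : Set I) (X : Subgroup (I → A)) : vanishing s ≤ saturate s X :=
  fun _ hx => ⟨1, X.one_mem, hx⟩

theorem saturate_mono {s : Set I} {X Y : Subgroup (I → A)} (h : X ≤ Y) :
    saturate s X ≤ saturate s Y := fun _ ⟨y, hy, hxy⟩ => ⟨y, h hy, hxy⟩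

theorem saturate_anti {s t : Set I} (h : s ⊆ t) (X : Subgroup (I → A)) :
    saturate t X ≤ saturate s X := fun _ ⟨y, hy, hxy⟩ => ⟨y, hy, fun i hi => hxy i (h hi)⟩

theorem saturate_le_of_vanishing_le {s : Set I} {X Y : Subgroup (I → A)} (h : X ≤ Y)
    (hs : vanishing s ≤ Y) : saturate s X ≤ Y := by
  rintro x ⟨y, hy, hxy⟩
  have : y⁻¹ * x ∈ Y := hs fun i hi => by simp [hxy i hi]
  simpa using Y.mul_mem (h hy) this

/-- A family of subgroups of `A^I`, each of them defined by its restriction to a finite subset of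
`I`, which is stable under finite intersections and under projections to finite subsets of `I`, and
which satisfies the descending chain condition over every finite subset of `I`. -/
structure IsCylinderFamily (𝒲 : Set (Subgroup (I → A))) : Prop where
  inf_mem : ∀ W ∈ 𝒲, ∀ W' ∈ 𝒲, W ⊓ W' ∈ 𝒲
  vanishing_mem : ∀ E : Finset I, vanishing (E : Set I) ∈ 𝒲
  saturate_mem : ∀ W ∈ 𝒲, ∀ E : Finset I, saturate (E : Set I) W ∈ 𝒲
  exists_vanishing_le : ∀ W ∈ 𝒲, ∃ E : Finset I, vanishing (E : Set I) ≤ W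
  isWF : ∀ E : Finset I, {W | W ∈ 𝒲 ∧ vanishing (E : Set I) ≤ W}.IsWF

/-- The left cosets of the members of `𝒲`. -/
def IsCosetOf (𝒲 : Set (Subgroup (I → A))) (C : Set (I → A)) : Prop :=
  ∃ c, ∃ W ∈ 𝒲, C = {x | c⁻¹ * x ∈ W}

theorem setOf_inv_mul_mem_eq {Γ : Type*} [Group Γ] {W : Subgroup Γ} {c d : Γ} (h : c⁻¹ * d ∈ W) :
    {x | c⁻¹ * x ∈ W} = {x | d⁻¹ * x ∈ W} := by
  ext x
  have : c⁻¹ * x = c⁻¹ * d * (d⁻¹ * x) := by group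
  simp only [Set.mem_ofPred_eq, this]
  exact W.mul_mem_cancel_left h

theorem IsCosetOf.eq_of_mem {𝒲 : Set (Subgroup (I → A))} {C : Set (I → A)} (hC : IsCosetOf 𝒲 C)
    {c : I → A} (hc : c ∈ C) : ∃ W ∈ 𝒲, C = {x | c⁻¹ * x ∈ W} := by
  obtain ⟨d, W, hW, rfl⟩ := hC
  exact ⟨W, hW, setOf_inv_mul_mem_eq hc⟩

/-- The subgroups of `A^I` that are intersections of members of `𝒲`. -/
def IsClosedIn (𝒲 : Set (Subgroup (I → A))) (X : Subgroup (I → A)) : Prop :=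
  ∀ x, (∀ W ∈ 𝒲, X ≤ W → x ∈ W) → x ∈ X

theorem IsClosedIn.inf {𝒲 : Set (Subgroup (I → A))} {X Y : Subgroup (I → A)} (hX : IsClosedIn 𝒲 X)
    (hY : IsClosedIn 𝒲 Y) : IsClosedIn 𝒲 (X ⊓ Y) := fun x hx =>
  ⟨hX x fun W hW h => hx W hW (inf_le_left.trans h),
    hY x fun W hW h => hx W hW (inf_le_right.trans h)⟩

namespace IsCylinderFamily

variable {𝒲 : Set (Subgroup (I → A))} (h𝒲 : IsCylinderFamily 𝒲)
include h𝒲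

theorem top_mem : ⊤ ∈ 𝒲 := by
  convert h𝒲.vanishing_mem ∅
  ext x
  simp [mem_vanishing]

theorem isCosetOf_inter {C D : Set (I → A)} (hC : IsCosetOf 𝒲 C) (hD : IsCosetOf 𝒲 D)
    (hne : (C ∩ D).Nonempty) : IsCosetOf 𝒲 (C ∩ D) := by
  obtain ⟨c, hcC, hcD⟩ := hne
  obtain ⟨W, hW, rfl⟩ := hC.eq_of_mem hcC
  obtain ⟨W', hW', rfl⟩ := hD.eq_of_mem hcD
  exact ⟨c, W ⊓ W', h𝒲.inf_mem W hW W' hW', rfl⟩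

theorem isCosetOf_sInter {t : Set (Set (I → A))} (ht : t.Finite) (htC : ∀ C ∈ t, IsCosetOf 𝒲 C)
    (hne : (⋂₀ t).Nonempty) : IsCosetOf 𝒲 (⋂₀ t) := by
  induction t, ht using Set.Finite.induction_on with
  | empty => exact ⟨1, ⊤, h𝒲.top_mem, by simp⟩
  | insert _ _ ih =>
    rw [Set.sInter_insert] at hne ⊢
    exact h𝒲.isCosetOf_inter (htC _ (Set.mem_insert _ _))
      (ih (fun C hC => htC C (Set.mem_insert_of_mem _ hC)) hne.right) hne

theorem isCosetOf_setOf_eq (i : I) (c : I → A) : IsCosetOf 𝒲 {x | x i = c i} := by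
  refine ⟨c, _, h𝒲.vanishing_mem {i}, ?_⟩
  ext x
  simp [mem_vanishing, inv_mul_eq_one, eq_comm]

/-- Compactness of the cosets of a cylinder family. -/
theorem sInter_nonempty {F : Set (Set (I → A))} (hF : ∀ C ∈ F, IsCosetOf 𝒲 C)
    (hfip : ∀ t ⊆ F, t.Finite → (⋂₀ t).Nonempty) : (⋂₀ F).Nonempty := by
  obtain ⟨M, hFM, ⟨hMC, hMfip⟩, hmax⟩ := zorn_subset_nonempty
    {F : Set (Set (I → A)) | (∀ C ∈ F, IsCosetOf 𝒲 C) ∧ ∀ t ⊆ F, t.Finite → (⋂₀ t).Nonempty}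
    (by
      intro c hc hchain hne
      refine ⟨⋃₀ c, ⟨?_, ?_⟩, fun s hs => Set.subset_sUnion_of_mem hs⟩
      · rintro C ⟨s, hs, hC⟩
        exact (hc hs).1 C hC
      · intro t ht htf
        obtain ⟨s, hs, hts⟩ := hchain.directedOn.exists_mem_subset_of_finite_of_subset_sUnion
          hne htf ht
        exact (hc hs).2 t hts htf) F ⟨hF, hfip⟩
  -- Maximality: a coset meeting every finite intersection from `M` already belongs to `M`.
  have hmem : ∀ C, IsCosetOf 𝒲 C → (∀ t ⊆ M, t.Finite → (C ∩ ⋂₀ t).Nonempty) → C ∈ M := by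
    intro C hC hCM
    refine hmax (y := insert C M) ⟨?_, ?_⟩ (Set.subset_insert _ _) (Set.mem_insert _ _)
    · rintro D (rfl | hD)
      exacts [hC, hMC D hD]
    · intro t ht htf
      refine (hCM (t \ {C}) (by simpa using ht) htf.sdiff).mono ?_
      rintro x ⟨hxC, hx⟩ D hD
      by_cases hDC : D = C
      · exact hDC ▸ hxC
      · exact hx D ⟨hD, hDC⟩
  have hsup : ∀ t ⊆ M, t.Finite → ∀ C, IsCosetOf 𝒲 C → ⋂₀ t ⊆ C → C ∈ M := by
    intro t ht htf C hC htC
    refine hmem C hC fun t' ht' htf' => ?_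
    refine (hMfip (t ∪ t') (Set.union_subset ht ht') (htf.union htf')).mono ?_
    rw [Set.sInter_union]
    exact Set.inter_subset_inter_left _ htC
  have hpt : ∀ i, ∃ a : A, {x : I → A | x i = a} ∈ M := by
    intro i
    -- The chain condition at the single coordinate `i` gives a smallest coset `c₀ W₀` in `M`
    -- depending on `i` only; `c₀ i` is the value sought.
    obtain ⟨W₀, ⟨⟨hW₀, hiW₀⟩, c₀, hc₀⟩, hmin⟩ := exists_minimal_of_isWF (h𝒲.isWF {i})
      (T := {W | (W ∈ 𝒲 ∧ vanishing ((({i} : Finset I) : Set I)) ≤ W) ∧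
        ∃ c, {x | c⁻¹ * x ∈ W} ∈ M}) (fun W hW => hW.1)
      ⟨⊤, ⟨h𝒲.top_mem, le_top⟩, 1, hsup ∅ (Set.empty_subset _) Set.finite_empty _
        ⟨1, ⊤, h𝒲.top_mem, rfl⟩ (by simp)⟩
    refine ⟨c₀ i, hmem _ (h𝒲.isCosetOf_setOf_eq i c₀) fun t ht htf => ?_⟩
    obtain ⟨c, hc⟩ := hMfip t ht htf
    obtain ⟨W, hW, htW⟩ := (h𝒲.isCosetOf_sInter htf (fun C hC => hMC C (ht hC)) ⟨c, hc⟩).eq_of_mem hc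
    have hsat := h𝒲.saturate_mem W hW {i}
    have hsatM : {x | c⁻¹ * x ∈ saturate (({i} : Finset I) : Set I) W} ∈ M :=
      hsup t ht htf _ ⟨c, _, hsat, rfl⟩ (by
        rw [htW]
        exact fun x hx => le_saturate _ _ hx)
    obtain ⟨d, hd⟩ := hMfip _ (Set.pair_subset hsatM hc₀) (Set.toFinite _)
    rw [Set.sInter_pair] at hd
    have hdM : {x | d⁻¹ * x ∈ saturate (({i} : Finset I) : Set I) W ⊓ W₀} ∈ M := by
      refine hsup _ (Set.pair_subset hsatM hc₀) (Set.toFinite _) _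
        ⟨d, _, h𝒲.inf_mem _ hsat _ hW₀, rfl⟩ ?_
      rw [Set.sInter_pair, setOf_inv_mul_mem_eq hd.1, setOf_inv_mul_mem_eq hd.2]
      exact fun x hx => hx
    -- By minimality, `c₀ W₀` lies in the saturation at `i` of `⋂₀ t`, so some point of `⋂₀ t` takes
    -- the value `c₀ i` at `i`.
    have hle : W₀ ≤ saturate (({i} : Finset I) : Set I) W :=
      (hmin ⟨⟨h𝒲.inf_mem _ hsat _ hW₀, le_inf (vanishing_le_saturate _ _) hiW₀⟩, d, hdM⟩
        inf_le_right).trans inf_le_left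
    have hc₀d : c⁻¹ * c₀ ∈ saturate (({i} : Finset I) : Set I) W := by
      have : c⁻¹ * c₀ = c⁻¹ * d * (c₀⁻¹ * d)⁻¹ := by group
      rw [this]
      exact mul_mem hd.1 (inv_mem (hle hd.2))
    obtain ⟨y, hy, hyi⟩ := hc₀d
    refine ⟨c * y, ?_, ?_⟩
    · have := hyi i (by simp)
      simp only [Pi.mul_apply, Pi.inv_apply] at this
      simp [← this]
    · rw [htW]
      simpa using hy
  choose a ha using hpt
  refine ⟨a, fun C hC => ?_⟩
  obtain ⟨c, W, hW, rfl⟩ := hMC C (hFM hC)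
  obtain ⟨E, hE⟩ := h𝒲.exists_vanishing_le W hW
  -- The coset depends only on the finite set `E`, so a point of it agreeing with `a` on `E`
  -- suffices.
  obtain ⟨x, hx⟩ := hMfip (insert {x | c⁻¹ * x ∈ W} ((fun i => {x : I → A | x i = a i}) '' E))
    (Set.insert_subset (hFM hC) (by rintro _ ⟨i, -, rfl⟩; exact ha i))
    ((E.finite_toSet.image _).insert _)
  rw [Set.sInter_insert] at hx
  have hxa : x⁻¹ * a ∈ W := hE fun i hi => by
    have : x i = a i := hx.2 _ ⟨i, hi, rfl⟩
    simp [this]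
  have hxW : c⁻¹ * x ∈ W := hx.1
  simpa [mul_assoc] using W.mul_mem hxW hxa

theorem isClosedIn_vanishing (s : Set I) : IsClosedIn 𝒲 (vanishing s) := fun x hx i hi =>
  hx _ (h𝒲.vanishing_mem {i}) (vanishing_anti (by simpa using hi)) i (by simp)

/-- `X` is the intersection of the members of `𝒲` above it, and these are stable under finite
intersection, so `hfip` need only treat one `W` at a time. -/
theorem exists_mem_of_isClosedIn {X : Subgroup (I → A)} (hX : IsClosedIn 𝒲 X)
    {F : Set (Set (I → A))} (hF : ∀ C ∈ F, IsCosetOf 𝒲 C)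
    (hfip : ∀ W ∈ 𝒲, X ≤ W → ∀ t ⊆ F, t.Finite → ((W : Set (I → A)) ∩ ⋂₀ t).Nonempty) :
    ((X : Set (I → A)) ∩ ⋂₀ F).Nonempty := by
  obtain ⟨x, hx⟩ := h𝒲.sInter_nonempty
    (F := (fun W : Subgroup (I → A) => (W : Set (I → A))) '' {W | W ∈ 𝒲 ∧ X ≤ W} ∪ F)
    (by
      rintro C (⟨W, hW, rfl⟩ | hC)
      · exact ⟨1, W, hW.1, by simp⟩
      · exact hF C hC)
    (by
      intro t ht htf
      suffices ∃ W ∈ 𝒲, X ≤ W ∧ ∃ t' ⊆ F, t'.Finite ∧ (W : Set (I → A)) ∩ ⋂₀ t' ⊆ ⋂₀ t by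
        obtain ⟨W, hW, hXW, t', ht', htf', hsub⟩ := this
        exact (hfip W hW hXW t' ht' htf').mono hsub
      induction t, htf using Set.Finite.induction_on with
      | empty => exact ⟨⊤, h𝒲.top_mem, le_top, ∅, by simp, by simp, by simp⟩
      | @insert C t _ _ ih =>
        obtain ⟨W, hW, hXW, t', ht', htf', hsub⟩ := ih ((Set.subset_insert _ _).trans ht)
        rw [Set.sInter_insert]
        rcases ht (Set.mem_insert _ _) with ⟨W', hW', rfl⟩ | hC
        · exact ⟨W' ⊓ W, h𝒲.inf_mem _ hW'.1 _ hW, le_inf hW'.2 hXW, t', ht', htf',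
            fun x hx => ⟨hx.1.1, hsub ⟨hx.1.2, hx.2⟩⟩⟩
        · exact ⟨W, hW, hXW, insert C t', Set.insert_subset hC ht', htf'.insert _,
            fun x hx => ⟨hx.2 _ (Set.mem_insert _ _),
              hsub ⟨hx.1, fun D hD => hx.2 D (Set.mem_insert_of_mem _ hD)⟩⟩⟩)
  exact ⟨x, hX x fun W hW h => hx _ (.inl ⟨W, ⟨hW, h⟩, rfl⟩), fun C hC => hx C (.inr hC)⟩

theorem isClosedIn_saturate {X : Subgroup (I → A)} (hX : IsClosedIn 𝒲 X) (s : Set I) :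
    IsClosedIn 𝒲 (saturate s X) := by
  intro y hy
  obtain ⟨x, hxX, hx⟩ := h𝒲.exists_mem_of_isClosedIn hX
    (F := (fun i => {x : I → A | x i = y i}) '' s)
    (by
      rintro _ ⟨i, -, rfl⟩
      exact h𝒲.isCosetOf_setOf_eq i y)
    (by
      intro W hW hXW t ht htf
      lift t to Finset (Set (I → A)) using htf
      classical
      obtain ⟨E, hE, rfl⟩ := Finset.subset_set_image_iff.mp ht
      obtain ⟨x, hx, hxy⟩ := hy (saturate (E : Set I) W) (h𝒲.saturate_mem W hW E)
        ((saturate_mono hXW).trans (saturate_anti hE _))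
      refine ⟨x, hx, ?_⟩
      rw [Finset.coe_image]
      rintro _ ⟨i, hi, rfl⟩
      exact (hxy i hi).symm)
  exact ⟨x, hxX, fun i hi => (hx _ ⟨i, hi, rfl⟩).symm⟩

/-- A minimal member of `𝒲` above `X` lies below every other one, hence equals `X`. -/
theorem mem_of_isClosedIn_of_vanishing_le {X : Subgroup (I → A)} (hX : IsClosedIn 𝒲 X)
    {E : Finset I} (hE : vanishing (E : Set I) ≤ X) : X ∈ 𝒲 := by
  obtain ⟨W₀, ⟨hW₀, hXW₀⟩, hmin⟩ := exists_minimal_of_isWF (h𝒲.isWF E)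
    (T := {W | W ∈ 𝒲 ∧ X ≤ W}) (fun W hW => ⟨hW.1, hE.trans hW.2⟩) ⟨⊤, h𝒲.top_mem, le_top⟩
  have : W₀ ≤ X := fun x hx => hX x fun W hW h =>
    (hmin (y := W ⊓ W₀) ⟨h𝒲.inf_mem _ hW _ hW₀, le_inf h hXW₀⟩ inf_le_right hx).1
  exact le_antisymm hXW₀ this ▸ hW₀

end IsCylinderFamily

end Cylinder

/-! ### Descending chain condition for closed invariant subgroups. -/

section Noetherian

open scoped Pointwise

variable {G : Type v} [Group G] {A : Type u} [Group A]

/-- Invariance under the shift action of a subgroup of `G`. -/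
def IsInvariant (H : Subgroup G) (X : Subgroup (G → A)) : Prop :=
  ∀ h ∈ H, ∀ x ∈ X, shift h x ∈ X

/-- The `H`-invariant closed subgroups of `A^G` that are defined by their restriction to `H J`. -/
def closedInvariant (𝒲 : Set (Subgroup (G → A))) (H : Subgroup G) (J : Set G) :
    Set (Subgroup (G → A)) :=
  {X | IsClosedIn 𝒲 X ∧ IsInvariant H X ∧ vanishing ((H : Set G) * J) ≤ X}

/-- The subgroup `H` of `G` acts in a Noetherian way on the closed subgroups of `A^G`. -/
def HasDCC (𝒲 : Set (Subgroup (G → A))) (H : Subgroup G) : Prop :=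
  ∀ J : Finset G, (closedInvariant 𝒲 H J).IsWF

/-- The values on `B` of the elements of `X` that vanish on `t⁻¹ B, …, t⁻ⁿ B`. -/
def leadingPart (B : Set G) (t : G) (n : ℕ) (X : Subgroup (G → A)) : Subgroup (G → A) :=
  saturate B (X ⊓ vanishing {g | ∃ k, 1 ≤ k ∧ k ≤ n ∧ t ^ k * g ∈ B})

theorem leadingPart_mono {B : Set G} {t : G} {n : ℕ} {X Y : Subgroup (G → A)} (h : X ≤ Y) :
    leadingPart B t n X ≤ leadingPart B t n Y :=
  saturate_mono (inf_le_inf_right _ h)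

theorem leadingPart_anti {B : Set G} {t : G} {m n : ℕ} (h : m ≤ n) (X : Subgroup (G → A)) :
    leadingPart B t n X ≤ leadingPart B t m X :=
  saturate_mono (inf_le_inf_left _ (vanishing_anti
    fun _ ⟨k, h1, hk, hg⟩ => ⟨k, h1, hk.trans h, hg⟩))

/-- The division step of Hilbert's theorem: the error `x⁻¹ * y`, moved by `t⁻ⁿ`, vanishes on `t⁻¹ B,
…, t⁻ⁿ B`, so its values on `B` are those of some `w ∈ X` vanishing there too. Multiplying `x` by
the translate of `w` corrects it on `tⁿ B` without spoiling the earlier layers. -/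
theorem exists_mem_eq_of_leadingPart_le {B : Set G} {t : G} {X Y : Subgroup (G → A)} (hXY : X ≤ Y)
    (hX : ∀ n : ℕ, ∀ x ∈ X, shift (t ^ n) x ∈ X) (hY : ∀ n : ℕ, ∀ y ∈ Y, shift (t ^ n)⁻¹ y ∈ Y)
    (hlead : ∀ n, leadingPart B t n Y ≤ leadingPart B t n X) {y : G → A} (hy : y ∈ Y) (n : ℕ) :
    ∃ x ∈ X, ∀ k < n, ∀ b ∈ B, x (t ^ k * b) = y (t ^ k * b) := by
  induction n with
  | zero => exact ⟨1, X.one_mem, by simp⟩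
  | succ n ih =>
    obtain ⟨x, hx, hxy⟩ := ih
    have hz : shift (t ^ n)⁻¹ (x⁻¹ * y) ∈ leadingPart B t n Y := by
      refine le_saturate _ _ ⟨hY n _ (Y.mul_mem (Y.inv_mem (hXY hx)) hy), ?_⟩
      rintro g ⟨k, h1k, hkn, hg⟩
      have hg' : t ^ n * g = t ^ (n - k) * (t ^ k * g) := by
        rw [← mul_assoc, ← pow_add, Nat.sub_add_cancel hkn]
      have := hxy (n - k) (by omega) _ hg
      simp [shift, hg', this]
    obtain ⟨w, ⟨hwX, hw⟩, hwz⟩ := hlead n hz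
    refine ⟨x * shift (t ^ n) w, X.mul_mem hx (hX n w hwX), fun k hk b hb => ?_⟩
    rcases Nat.lt_succ_iff_lt_or_eq.mp hk with hk | rfl
    · have : w ((t ^ n)⁻¹ * (t ^ k * b)) = 1 := hw _ ⟨n - k, by omega, by omega, by
        convert hb using 1
        rw [← mul_assoc, ← mul_assoc, mul_assoc _ _ (t ^ k), mul_eq_right, pow_sub _ hk.le]
        group⟩
      simp [shift, this, hxy k hk b hb]
    · have := hwz b hb
      simp only [shift, inv_inv, Pi.mul_apply, Pi.inv_apply] at this
      simp [shift, ← this]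

theorem IsCylinderFamily.le_of_leadingPart_le {𝒲 : Set (Subgroup (G → A))}
    (h𝒲 : IsCylinderFamily 𝒲) {H H' : Subgroup G} {t : G} (ht : t ∈ H')
    (hgen : ∀ g ∈ H', ∃ n : ℤ, ∃ h ∈ H, g = t ^ n * h) {J : Set G} {X Y : Subgroup (G → A)}
    (hX : X ∈ closedInvariant 𝒲 H' J) (hY : IsInvariant H' Y) (hXY : X ≤ Y)
    (hlead : ∀ n, leadingPart ((H : Set G) * J) t n Y ≤ leadingPart ((H : Set G) * J) t n X) : Y ≤ X := by
  classical
  intro y hy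
  refine hX.1 y fun W hW hXW => ?_
  obtain ⟨E, hE⟩ := h𝒲.exists_vanishing_le W hW
  have hpow : ∀ g ∈ (H' : Set G) * J, ∃ n : ℤ, ∃ b ∈ (H : Set G) * J, g = t ^ n * b := by
    rintro _ ⟨g, hg, j, hj, rfl⟩
    obtain ⟨n, h, hh, rfl⟩ := hgen g hg
    exact ⟨n, h * j, Set.mul_mem_mul hh hj, mul_assoc _ _ _⟩
  choose! n b hb hnb using hpow
  -- `a` bounds every exponent `|n e|`, so after a shift by `t ^ a` the exponents lie between `0`
  -- and `2 * a`.
  set a : ℕ := ∑ e ∈ E, (n e).natAbs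
  obtain ⟨x, hx, hxy⟩ := exists_mem_eq_of_leadingPart_le hXY
    (fun n x hx => hX.2.1 _ (H'.pow_mem ht n) x hx)
    (fun n y hy => hY _ (H'.inv_mem (H'.pow_mem ht n)) y hy) hlead
    (hY _ (H'.pow_mem ht a) y hy) (2 * a + 1)
  have hxE : ∀ e ∈ E, e ∈ (H' : Set G) * J → x (t ^ a * e) = y e := by
    intro e he heJ
    have hle : (n e).natAbs ≤ a :=
      Finset.single_le_sum (f := fun e => (n e).natAbs) (fun _ _ => Nat.zero_le _) he
    have hk : t ^ a * e = t ^ (n e + a).toNat * b e := by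
      conv_lhs => rw [hnb e heJ]
      rw [← zpow_natCast, ← zpow_natCast, Int.toNat_of_nonneg (by omega), ← mul_assoc, ← zpow_add,
        add_comm]
    have := hxy (n e + a).toNat (by omega) (b e) (hb e heJ)
    rw [← hk] at this
    simpa [shift] using this
  set x' := shift (t ^ a)⁻¹ x
  have hx' : x' ∈ X := hX.2.1 _ (H'.inv_mem (H'.pow_mem ht a)) x hx
  -- `w` corrects the values off `H' J`; it lies in `X` because `X` is determined by its restriction
  -- to `H' J`.
  set w : G → A := fun g => if g ∈ (H' : Set G) * J then 1 else (x' g)⁻¹ * y g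
  have hw : w ∈ X := hX.2.2 fun g hg => if_pos hg
  have key : (x' * w)⁻¹ * y ∈ W := hE fun e he => by
    by_cases heJ : e ∈ (H' : Set G) * J
    · have : x' e = y e := by simpa [x', shift] using hxE e he heJ
      simp [w, heJ, this]
    · simp [w, heJ]
  simpa only [mul_inv_cancel_left] using W.mul_mem (hXW (X.mul_mem hx' hw)) key

theorem IsCylinderFamily.leadingPart_mem {𝒲 : Set (Subgroup (G → A))} (h𝒲 : IsCylinderFamily 𝒲)
    {H H' : Subgroup G} (hHH' : H ≤ H') {t : G} (ht : t ∈ H')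
    (hnormal : ∀ g ∈ H', ∀ h ∈ H, g * h * g⁻¹ ∈ H) {J J' : Set G} {X : Subgroup (G → A)}
    (hX : X ∈ closedInvariant 𝒲 H' J') (n : ℕ) :
    leadingPart ((H : Set G) * J) t n X ∈ closedInvariant 𝒲 H J := by
  have hmul : ∀ h ∈ H, ∀ b ∈ (H : Set G) * J, h * b ∈ (H : Set G) * J := by
    rintro h hh _ ⟨g, hg, j, hj, rfl⟩
    exact ⟨h * g, H.mul_mem hh hg, j, hj, mul_assoc _ _ _⟩
  refine ⟨h𝒲.isClosedIn_saturate (hX.1.inf (h𝒲.isClosedIn_vanishing _)) _, ?_,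
    vanishing_le_saturate _ _⟩
  rintro h hh x ⟨y, ⟨hyX, hy⟩, hxy⟩
  refine ⟨shift h y, ⟨hX.2.1 h (hHH' hh) y hyX, ?_⟩,
    fun g hg => hxy _ (hmul _ (H.inv_mem hh) _ hg)⟩
  rintro g ⟨k, h1, hk, hg⟩
  refine hy _ ⟨k, h1, hk, ?_⟩
  have : t ^ k * (h⁻¹ * g) = t ^ k * h⁻¹ * (t ^ k)⁻¹ * (t ^ k * g) := by group
  rw [this]
  exact hmul _ (hnormal _ (H'.pow_mem ht k) _ (H.inv_mem hh)) _ hg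

/-- A cyclic extension preserves the descending chain condition, as in the Hilbert basis
theorem. -/
theorem HasDCC.of_cyclic {𝒲 : Set (Subgroup (G → A))} (h𝒲 : IsCylinderFamily 𝒲)
    {H H' : Subgroup G} (hH : HasDCC 𝒲 H) (hHH' : H ≤ H') {t : G} (ht : t ∈ H')
    (hgen : ∀ g ∈ H', ∃ n : ℤ, ∃ h ∈ H, g = t ^ n * h)
    (hnormal : ∀ g ∈ H', ∀ h ∈ H, g * h * g⁻¹ ∈ H) : HasDCC 𝒲 H' := by
  intro J
  rw [Set.isWF_iff_no_descending_seq]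
  intro X hanti hX
  replace hX : ∀ m, X m ∈ closedInvariant 𝒲 H' J := hX
  have hmem : ∀ n m, leadingPart ((H : Set G) * (J : Set G)) t n (X m) ∈ closedInvariant 𝒲 H J := fun n m =>
    h𝒲.leadingPart_mem hHH' ht hnormal (hX m) n
  -- Leading parts decrease in both indices. A minimal one at `(n₀, m₀)` settles all rows `n ≥ n₀`,
  -- and the finitely many rows below `n₀` stabilise separately.
  obtain ⟨_, ⟨⟨n₀, m₀⟩, rfl⟩, hmin₀⟩ := exists_minimal_of_isWF (hH J)
    (T := Set.range fun p : ℕ × ℕ => leadingPart ((H : Set G) * (J : Set G)) t p.1 (X p.2))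
    (by rintro _ ⟨p, rfl⟩; exact hmem _ _) ⟨_, (0, 0), rfl⟩
  have hrow : ∀ n, ∃ m, ∀ m', leadingPart ((H : Set G) * (J : Set G)) t n (X m') ≤
      leadingPart ((H : Set G) * (J : Set G)) t n (X m) → leadingPart ((H : Set G) * (J : Set G)) t n (X m) ≤
      leadingPart ((H : Set G) * (J : Set G)) t n (X m') := by
    intro n
    obtain ⟨_, ⟨m, rfl⟩, hmin⟩ := exists_minimal_of_isWF (hH J)
      (T := Set.range fun m : ℕ => leadingPart ((H : Set G) * (J : Set G)) t n (X m))
      (by rintro _ ⟨m, rfl⟩; exact hmem _ _) ⟨_, 0, rfl⟩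
    exact ⟨m, fun m' h => hmin ⟨m', rfl⟩ h⟩
  choose m hm using hrow
  set M := m₀ + ∑ n ∈ Finset.range n₀, m n
  have hle : ∀ n, leadingPart ((H : Set G) * (J : Set G)) t n (X M) ≤
      leadingPart ((H : Set G) * (J : Set G)) t n (X (M + 1)) := by
    intro n
    by_cases hn : n < n₀
    · have hmM : m n ≤ M := (Finset.single_le_sum (f := m) (fun _ _ => Nat.zero_le _)
        (Finset.mem_range.mpr hn)).trans (Nat.le_add_left _ _)
      exact (leadingPart_mono (hanti.antitone hmM)).trans
        (hm n (M + 1) (leadingPart_mono (hanti.antitone (hmM.trans (Nat.le_succ _)))))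
    · have hm₀M : m₀ ≤ M := Nat.le_add_right _ _
      have hn := not_lt.mp hn
      exact ((leadingPart_anti hn _).trans (leadingPart_mono (hanti.antitone hm₀M))).trans
        (hmin₀ ⟨(n, M + 1), rfl⟩ ((leadingPart_anti hn _).trans
          (leadingPart_mono (hanti.antitone (hm₀M.trans (Nat.le_succ _))))))
  exact (hanti (Nat.lt_succ_self M)).not_ge (h𝒲.le_of_leadingPart_le ht hgen (hX (M + 1))
    (hX M).2.1 (hanti.antitone (Nat.le_succ M)) hle)

/-- Since `H' ⊆ H T`, a subgroup determined on `H' J` is determined on `H (T J)`, and `T J` is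
finite. -/
theorem HasDCC.of_finite {𝒲 : Set (Subgroup (G → A))} {H H' : Subgroup G} (hH : HasDCC 𝒲 H)
    (hHH' : H ≤ H') {T : Finset G} (hT : ∀ g ∈ H', ∃ h ∈ H, ∃ t ∈ T, g = h * t) :
    HasDCC 𝒲 H' := by
  classical
  intro J
  refine (hH (T * J)).mono fun X hX => ⟨hX.1, fun h hh => hX.2.1 h (hHH' hh),
    (vanishing_anti ?_).trans hX.2.2⟩
  rintro _ ⟨g, hg, j, hj, rfl⟩
  obtain ⟨h, hh, t, ht, rfl⟩ := hT g hg
  refine ⟨h, hh, t * j, ?_, (mul_assoc _ _ _).symm⟩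
  rw [Finset.coe_mul]
  exact Set.mul_mem_mul ht hj

theorem IsCylinderFamily.hasDCC_bot {𝒲 : Set (Subgroup (G → A))} (h𝒲 : IsCylinderFamily 𝒲) :
    HasDCC 𝒲 ⊥ := by
  intro J
  refine (h𝒲.isWF J).mono fun X hX => ?_
  have h : vanishing (J : Set G) ≤ X := by simpa using hX.2.2
  exact ⟨h𝒲.mem_of_isClosedIn_of_vanishing_le hX.1 h, h⟩

theorem IsPolycyclicByFinite.hasDCC_top (hG : IsPolycyclicByFinite G)
    {𝒲 : Set (Subgroup (G → A))} (h𝒲 : IsCylinderFamily 𝒲) : HasDCC 𝒲 (⊤ : Subgroup G) := by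
  classical
  obtain ⟨n, S, h0, hn, hS⟩ := hG
  suffices ∀ k ≤ n, HasDCC 𝒲 (S k) from hn ▸ this n le_rfl
  intro k hk
  induction k with
  | zero => exact h0 ▸ h𝒲.hasDCC_bot
  | succ k ih =>
    obtain ⟨hle, hN, hQ⟩ := hS k hk
    have hnormal : ∀ g ∈ S (k + 1), ∀ h ∈ S k, g * h * g⁻¹ ∈ S k := fun g hg h hh =>
      hN.conj_mem ⟨h, hle hh⟩ hh ⟨g, hg⟩
    rcases hQ with hQ | hQ
    · obtain ⟨q, hq⟩ := hQ.exists_generator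
      obtain ⟨t, rfl⟩ := QuotientGroup.mk_surjective q
      refine (ih (by omega)).of_cyclic h𝒲 hle t.2 (fun g hg => ?_) hnormal
      obtain ⟨m, hm⟩ := hq (QuotientGroup.mk ⟨g, hg⟩)
      refine ⟨m, (t : G) ^ (-m) * g, ?_, by simp⟩
      have hm : ((t ^ m : S (k + 1)) : S (k + 1) ⧸ (S k).subgroupOf (S (k + 1))) =
        QuotientGroup.mk ⟨g, hg⟩ := hm
      rw [QuotientGroup.eq, Subgroup.mem_subgroupOf] at hm
      simpa using hm
    · have := Fintype.ofFinite (S (k + 1) ⧸ (S k).subgroupOf (S (k + 1)))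
      refine (ih (by omega)).of_finite hle (T := Finset.univ.image fun
        q : S (k + 1) ⧸ (S k).subgroupOf (S (k + 1)) => (q.out : G)) fun g hg => ?_
      set q : S (k + 1) ⧸ (S k).subgroupOf (S (k + 1)) := QuotientGroup.mk ⟨g, hg⟩ with hq
      have hout : (q.out : G)⁻¹ * g ∈ S k := by
        have : (QuotientGroup.mk q.out : S (k + 1) ⧸ (S k).subgroupOf (S (k + 1))) =
          QuotientGroup.mk ⟨g, hg⟩ := by rw [QuotientGroup.out_eq']
        rw [QuotientGroup.eq, Subgroup.mem_subgroupOf] at this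
        simpa using this
      -- Normality turns the left coset representative into a right one.
      refine ⟨_, hnormal q.out q.out.2 _ hout, q.out, by simp, by group⟩

/-- Over a polycyclic-by-finite group, a closed invariant subgroup of `A^G` is determined by a
finite window. -/
theorem IsPolycyclicByFinite.exists_window (hG : IsPolycyclicByFinite G)
    {𝒲 : Set (Subgroup (G → A))} (h𝒲 : IsCylinderFamily 𝒲)
    (hshift : ∀ W ∈ 𝒲, ∀ g : G, ∃ W' ∈ 𝒲, ∀ x, x ∈ W' ↔ shift g x ∈ W)
    {X : Subgroup (G → A)} (hX : ∀ x, (∀ E : Finset G, x ∈ saturate (E : Set G) X) → x ∈ X)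
    (hXE : ∀ E : Finset G, saturate (E : Set G) X ∈ 𝒲) (hinv : ∀ g, ∀ x ∈ X, shift g x ∈ X) :
    ∃ E : Finset G, ∀ x, x ∈ X ↔ ∀ g : G, shift g⁻¹ x ∈ saturate (E : Set G) X := by
  classical
  -- `Y E` is the finite type approximation of `X` with window `E`; it decreases as `E` grows.
  let Y : Finset G → Subgroup (G → A) := fun E =>
    { carrier := {x | ∀ g, shift g x ∈ saturate (E : Set G) X}
      mul_mem' := fun hx hy g => mul_mem (hx g) (hy g)
      one_mem' := fun g => one_mem (saturate (E : Set G) X)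
      inv_mem' := fun hx g => inv_mem (hx g) }
  have hYclosed : ∀ E, Y E ∈ closedInvariant 𝒲 ⊤ ((({1} : Finset G) : Set G)) := by
    intro E
    refine ⟨fun x hx g => ?_, fun h _ x hx g => ?_, fun x hx => ?_⟩
    · obtain ⟨W', hW', hxW'⟩ := hshift _ (hXE E) g
      exact (hxW' x).mp (hx W' hW' fun y hy => (hxW' y).mpr (hy g))
    · have : shift g (shift h x) = shift (g * h) x := by
        funext k
        simp [shift, mul_assoc]
      rw [this]
      exact hx _
    · have : x = 1 := funext fun g => hx g (by simp)
      exact this ▸ one_mem _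
  -- With `H = ⊤` and `J = {1}` the set `H J` is all of `G`, so the chain condition covers all
  -- closed invariant subgroups. Minimality gives `Y E ≤ Y (E ∪ E') ≤ Y E'` for every `E'`.
  obtain ⟨_, ⟨E, rfl⟩, hmin⟩ := exists_minimal_of_isWF (hG.hasDCC_top h𝒲 {1})
    (T := Set.range Y) (by rintro _ ⟨E, rfl⟩; exact hYclosed E) ⟨_, ∅, rfl⟩
  refine ⟨E, fun x => ⟨fun hx g => le_saturate _ _ (hinv _ x hx), fun hx => hX x fun E' => ?_⟩⟩
  have hxE : x ∈ Y E := fun g => by simpa using hx g⁻¹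
  have hmono : ∀ {E₁ E₂ : Finset G}, E₁ ⊆ E₂ → Y E₂ ≤ Y E₁ := fun h y hy g =>
    saturate_anti (by exact_mod_cast h) X (hy g)
  have := hmono Finset.subset_union_right
    (hmin ⟨E ∪ E', rfl⟩ (hmono Finset.subset_union_left) hxE) 1
  have h1 : shift 1 x = x := by
    funext g
    simp [shift]
  rwa [h1] at this

end Noetherian

/-! ### Algebraic cylinders, and the theorem for subshifts and cellular automata. -/

section Algebraic

variable {G : Type v} [Group G] {K : Type u} [Field K]

/-- Reindexing as a group homomorphism. -/
def reindexHom (A : Type*) [Group A] {I I' : Type*} (r : I' → I) : (I → A) →* (I' → A) where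
  toFun x i := x (r i)
  map_one' := rfl
  map_mul' _ _ := rfl

/-- The restriction of configurations to `E` as a group homomorphism. -/
abbrev restrictHom (A : Type*) [Group A] (E : Finset G) : (G → A) →* (E → A) :=
  reindexHom A Subtype.val

omit [Group G] in
theorem restrictHom_surjective (A : Type*) [Group A] (E : Finset G) :
    Function.Surjective (restrictHom A E) := by
  classical
  intro c
  exact ⟨fun g => if h : g ∈ E then c ⟨g, h⟩ else 1, by
    funext e
    simp [reindexHom]⟩

omit [Group G] in
theorem mem_saturate_iff_restrict {A : Type*} [Group A] {E : Finset G} {X : Subgroup (G → A)}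
    {x : G → A} : x ∈ saturate (E : Set G) X ↔ E.restrict x ∈ X.map (restrictHom A E) := by
  refine exists_congr fun y => and_congr_right fun _ => ?_
  rw [funext_iff, Subtype.forall]
  exact forall₂_congr fun _ _ => eq_comm

/-- The subgroups of `V(K)^G` defined by an algebraic subgroup of `V^E` for some finite `E`. -/
def cylinders (G : Type v) (V : Over (Spec (.of K))) [GrpObj V] : Set (Subgroup (G → Points V)) :=
  {W | ∃ (E : Finset G) (C : Subgroup (E → Points V)), IsClosed (C : Set (E → Points V)) ∧
    ∀ x, x ∈ W ↔ E.restrict x ∈ C}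

variable {U V : Over (Spec (.of K))} [GrpObj U] [GrpObj V]

omit [Group G] in
theorem exists_isClosed_of_mem_cylinders {W : Subgroup (G → Points V)} (hW : W ∈ cylinders G V) :
    ∃ E : Finset G, ∀ F : Finset G, E ⊆ F → ∃ C : Subgroup (F → Points V),
      IsClosed (C : Set (F → Points V)) ∧ ∀ x, x ∈ W ↔ F.restrict x ∈ C := by
  obtain ⟨E, C, hC, hW⟩ := hW
  refine ⟨E, fun F hEF => ?_⟩
  let r : E → F := fun e => ⟨e.1, hEF e.2⟩
  exact ⟨C.comap (reindexHom _ r), hC.preimage (isRegular_reindex (V := V) r).continuous, hW⟩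

omit [Group G] in
theorem isClosed_comap {E E' : Finset G} {f : (E → Points U) →* (E' → Points V)}
    (hf : IsRegular f) {C : Subgroup (E' → Points V)} (hC : IsClosed (C : Set (E' → Points V))) :
    IsClosed (C.comap f : Set (E → Points U)) :=
  hC.preimage hf.continuous

variable [IsAlgClosed K]

omit [Group G] in
-- On a window containing both `E` and one defining `W`, this is a projection of a closed subgroup,
-- closed by `IsRegular.isClosed_map`.
theorem isClosed_map_restrictHom (hV : IsFiniteType V) {W : Subgroup (G → Points V)}
    (hW : W ∈ cylinders G V) (E : Finset G) :
    IsClosed (W.map (restrictHom _ E) : Set (E → Points V)) := by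
  classical
  obtain ⟨E', hE'⟩ := exists_isClosed_of_mem_cylinders hW
  obtain ⟨C, hC, hWC⟩ := hE' (E' ∪ E) Finset.subset_union_left
  let r : E → ↥(E' ∪ E) := fun e => ⟨e.1, Finset.subset_union_right e.2⟩
  have hmap : W.map (restrictHom _ E) = C.map (reindexHom _ r) := by
    have : W = C.comap (restrictHom _ (E' ∪ E)) := Subgroup.ext hWC
    have hr : restrictHom (Points V) E = (reindexHom _ r).comp (restrictHom _ (E' ∪ E)) := rfl
    rw [hr, ← Subgroup.map_map, this, Subgroup.map_comap_eq_self_of_surjective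
      (restrictHom_surjective _ _)]
  rw [hmap]
  exact IsRegular.isClosed_map hV hV (isRegular_reindex r) hC

theorem isCylinderFamily_cylinders (G : Type v) [Group G] (hV : IsFiniteType V) :
    IsCylinderFamily (cylinders G V) where
  inf_mem W hW W' hW' := by
    classical
    obtain ⟨E, hE⟩ := exists_isClosed_of_mem_cylinders hW
    obtain ⟨E', hE'⟩ := exists_isClosed_of_mem_cylinders hW'
    obtain ⟨C, hC, hWC⟩ := hE (E ∪ E') Finset.subset_union_left
    obtain ⟨C', hC', hWC'⟩ := hE' (E ∪ E') Finset.subset_union_right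
    exact ⟨E ∪ E', C ⊓ C', hC.inter hC', fun x => and_congr (hWC x) (hWC' x)⟩
  vanishing_mem E := by
    refine ⟨E, ⊥, by simpa using hV.isClosed_singleton (1 : E → Points V), fun x => ?_⟩
    rw [Subgroup.mem_bot, funext_iff, Subtype.forall]
    rfl
  saturate_mem W hW E :=
    ⟨E, _, isClosed_map_restrictHom hV hW E, fun _ => mem_saturate_iff_restrict⟩
  exists_vanishing_le W hW := by
    obtain ⟨E, C, -, hWC⟩ := hW
    refine ⟨E, fun x hx => (hWC x).mpr ?_⟩
    have : E.restrict x = 1 := funext fun e => hx e e.2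
    exact this ▸ C.one_mem
  isWF E := by
    have := hV.noetherianSpace (E := E)
    -- Restriction to `E` embeds these subgroups, in order, into the closed subsets of a Noetherian
    -- space.
    let D : {W | W ∈ cylinders G V ∧ vanishing (E : Set G) ≤ W} →
        TopologicalSpace.Closeds (E → Points V) :=
      fun W => ⟨W.1.map (restrictHom _ E), isClosed_map_restrictHom hV W.2.1 E⟩
    have hle : ∀ W W', D W ≤ D W' → W ≤ W' := by
      intro W W' h x hx
      obtain ⟨y, hy, hyx⟩ := h ⟨x, hx, rfl⟩
      exact saturate_le_of_vanishing_le le_rfl W'.2.2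
        ⟨y, hy, fun e he => (congrFun hyx ⟨e, he⟩).symm⟩
    have hD : StrictMono D := fun W W' h =>
      lt_of_le_not_ge (Set.image_mono h.le) fun h' => h.not_ge (hle _ _ h')
    exact hD.wellFoundedLT.wf

omit [IsAlgClosed K] in
theorem exists_mem_cylinders_shift {W : Subgroup (G → Points V)} (hW : W ∈ cylinders G V) (g : G) :
    ∃ W' ∈ cylinders G V, ∀ x, x ∈ W' ↔ shift g x ∈ W := by
  classical
  obtain ⟨E, C, hC, hWC⟩ := hW
  let r : E → E.image fun e => g⁻¹ * e := fun e => ⟨g⁻¹ * e.1, Finset.mem_image_of_mem _ e.2⟩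
  exact ⟨W.comap (reindexHom _ fun h => g⁻¹ * h), ⟨_, C.comap (reindexHom _ r),
    hC.preimage (isRegular_reindex (V := V) r).continuous, fun x => hWC _⟩, fun x => Iff.rfl⟩

/-- A shift-invariant subgroup of `V(K)^G` that is prodiscretely closed and whose restrictions to
finite sets are closed is of finite type, if `G` is polycyclic-by-finite. -/
theorem IsPolycyclicByFinite.isAlgGroupSFT (hG : IsPolycyclicByFinite G) (hV : IsFiniteType V)
    {X : Subgroup (G → Points V)}
    (hX : ∀ x, (∀ E : Finset G, x ∈ saturate (E : Set G) X) → x ∈ X)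
    (hXE : ∀ E : Finset G, IsClosed (X.map (restrictHom _ E) : Set (E → Points V)))
    (hinv : ∀ g, ∀ x ∈ X, shift g x ∈ X) : IsAlgGroupSFT V (X : Set (G → Points V)) := by
  obtain ⟨E, hE⟩ := hG.exists_window (isCylinderFamily_cylinders G hV)
    (fun W hW g => exists_mem_cylinders_shift hW g) hX
    (fun E => ⟨E, _, hXE E, fun _ => mem_saturate_iff_restrict⟩) hinv
  refine ⟨E, X.map (restrictHom _ E), ⟨⟨_, rfl⟩, isZariskiClosed_iff.mpr (hXE E)⟩, ?_⟩
  ext x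
  exact (hE x).trans (forall_congr' fun g => mem_saturate_iff_restrict)

omit [Group G] in
theorem IsProdiscreteClosed.mem {A : Type u} {X : Set (G → A)} (hX : IsProdiscreteClosed X)
    {x : G → A} (h : ∀ E : Finset G, ∃ y ∈ X, ∀ e ∈ E, x e = y e) : x ∈ X := by
  let : TopologicalSpace A := ⊥
  by_contra hx
  obtain ⟨E, u, hu, hsub⟩ := isOpen_pi_iff.mp (IsClosed.isOpen_compl (self := hX)) x hx
  obtain ⟨y, hy, hxy⟩ := h E
  exact hsub (fun e he => hxy e he ▸ (hu e he).2) hy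

omit [IsAlgClosed K] in
-- Only the finite restrictions are assumed to be subgroups; prodiscrete closedness transfers this
-- to `S` itself.
theorem IsAlgGroupSubshift.exists_subgroup {S : Set (G → Points V)}
    (hS : IsAlgGroupSubshift V S) : ∃ X : Subgroup (G → Points V), (X : Set (G → Points V)) = S ∧
      (∀ x, (∀ E : Finset G, x ∈ saturate (E : Set G) X) → x ∈ X) ∧
      (∀ E : Finset G, IsClosed (X.map (restrictHom _ E) : Set (E → Points V))) ∧
      ∀ g, ∀ x ∈ X, shift g x ∈ X := by
  have key : ∀ {x : G → Points V}, (∀ E : Finset G, E.restrict x ∈ restrictTo S E) → x ∈ S :=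
    fun h => hS.closed.mem fun E => by
      obtain ⟨y, hy, hyx⟩ := h E
      exact ⟨y, hy, fun e he => (congrFun hyx ⟨e, he⟩).symm⟩
  have hmem : ∀ {x : G → Points V}, x ∈ S → ∀ E : Finset G, E.restrict x ∈ restrictTo S E :=
    fun hx E => ⟨_, hx, rfl⟩
  let X : Subgroup (G → Points V) :=
    { carrier := S
      mul_mem' := fun {x y} hx hy => key fun E => by
        obtain ⟨⟨H, hH⟩, -⟩ := hS.restrict E
        have h1 := hmem hx E
        have h2 := hmem hy E
        rw [← hH] at h1 h2 ⊢
        exact H.mul_mem h1 h2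
      one_mem' := key fun E => by
        obtain ⟨⟨H, hH⟩, -⟩ := hS.restrict E
        rw [← hH]
        exact H.one_mem
      inv_mem' := fun {x} hx => key fun E => by
        obtain ⟨⟨H, hH⟩, -⟩ := hS.restrict E
        have h1 := hmem hx E
        rw [← hH] at h1 ⊢
        exact H.inv_mem h1 }
  exact ⟨X, rfl, fun x hx => hS.closed.mem fun E => hx E,
    fun E => isZariskiClosed_iff.mp (hS.restrict E).2, hS.shift_mem⟩

theorem IsAlgGroupSubshift.isAlgGroupSFT (hG : IsPolycyclicByFinite G) (hV : IsFiniteType V)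
    {S : Set (G → Points V)} (hS : IsAlgGroupSubshift V S) : IsAlgGroupSFT V S := by
  obtain ⟨X, rfl, hX, hXE, hinv⟩ := hS.exists_subgroup
  exact hG.isAlgGroupSFT hV hX hXE hinv

omit [IsAlgClosed K] in
theorem IsAlgGroupCA.exists_monoidHom {τ : (G → Points U) → (G → Points V)}
    (hτ : IsAlgGroupCA U V τ) : ∃ T : (G → Points U) →* (G → Points V), ⇑T = τ ∧
      (∀ g x, T (shift g x) = shift g (T x)) ∧
      ∀ E : Finset G, ∃ (E' : Finset G) (f : (E' → Points U) →* (E → Points V)),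
        IsRegular f ∧ ∀ x, E.restrict (T x) = f (E'.restrict x) := by
  classical
  obtain ⟨M, f, ⟨φ, hφ⟩, hf⟩ := hτ
  have hτf : ∀ x g, τ x g = f (reindexHom _ (fun m : M => g * m) x) := fun x g => by
    rw [hf]
    congr 1
    funext m
    simp [shift, reindexHom]
  refine ⟨⟨⟨τ, ?_⟩, ?_⟩, rfl, ?_, ?_⟩
  · funext g
    rw [hτf, map_one, map_one]
    rfl
  · intro x y
    funext g
    simp only [Pi.mul_apply]
    rw [hτf, hτf, hτf, map_mul, map_mul]
  · intro g x
    funext h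
    change τ (shift g x) h = τ x (g⁻¹ * h)
    rw [hτf, hτf]
    congr 1
    funext m
    simp [shift, reindexHom, mul_assoc]
  · intro E
    -- The values of `T x` on `E` depend only on `x` restricted to the product set `E M`.
    let E' : Finset G := Finset.image₂ (· * ·) E M
    let r : E → M → E' := fun e m => ⟨e.1 * m.1, Finset.mem_image₂_of_mem e.2 m.2⟩
    refine ⟨E', MonoidHom.pi fun e => f.comp (reindexHom _ (r e)), fun e => ?_, fun x => ?_⟩
    · obtain ⟨ψ, hψ⟩ := (isRegular_reindex (V := U) (r e)).exists_hom
      refine ⟨ψ ≫ φ, fun x => ?_⟩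
      rw [← Category.assoc, ← hψ, ← hφ]
      rfl
    · funext e
      exact hτf x e

omit [IsAlgClosed K] in
theorem isAlgGroupSFT_preimage {S : Set (G → Points V)} (hS : IsAlgGroupSFT V S)
    {τ : (G → Points U) → (G → Points V)} (hτ : IsAlgGroupCA U V τ) :
    IsAlgGroupSFT U (τ ⁻¹' S) := by
  obtain ⟨T, rfl, hT, hTE⟩ := hτ.exists_monoidHom
  obtain ⟨D, _, ⟨⟨H, rfl⟩, hH⟩, rfl⟩ := hS
  obtain ⟨D', f, hf, hTf⟩ := hTE D
  refine ⟨D', H.comap f, ⟨⟨_, rfl⟩, ?_⟩, ?_⟩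
  · rw [isZariskiClosed_iff] at hH ⊢
    exact isClosed_comap hf hH
  · ext x
    refine forall_congr' fun g => ?_
    rw [← hT, hTf]
    rfl

theorem isAlgGroupSFT_image (hG : IsPolycyclicByFinite G) (hU : IsFiniteType U)
    (hV : IsFiniteType V) {S : Set (G → Points U)} (hS : IsAlgGroupSubshift U S) {τ : (G → Points U) → (G → Points V)}
    (hτ : IsAlgGroupCA U V τ) : IsAlgGroupSFT V (τ '' S) := by
  obtain ⟨T, rfl, hT, hTE⟩ := hτ.exists_monoidHom
  obtain ⟨X, rfl, hX, hXE, hinv⟩ := hS.exists_subgroup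
  have h𝒲 := isCylinderFamily_cylinders G hU
  refine hG.isAlgGroupSFT (X := X.map T) hV (fun y hy => ?_) (fun E => ?_) ?_
  · have hXcl : IsClosedIn (cylinders G U) X := fun x hx => hX x fun E =>
      hx _ ⟨E, _, hXE E, fun _ => mem_saturate_iff_restrict⟩ (le_saturate _ _)
    have hyE : ∀ E : Finset G, ∃ x ∈ X, ∀ g ∈ E, y g = T x g := fun E => by
      obtain ⟨_, ⟨x, hx, rfl⟩, h⟩ := hy E
      exact ⟨x, hx, h⟩
    -- A preimage of `y` in `X` comes from compactness: each condition `T x g = y g` defines a coset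
    -- of a cylinder, and finitely many of them can be solved within `X`.
    obtain ⟨x, hxX, hx⟩ := h𝒲.exists_mem_of_isClosedIn hXcl
      (F := Set.range fun g => {x | T x g = y g})
      (by
        rintro _ ⟨g, rfl⟩
        obtain ⟨c, -, hc⟩ := hyE {g}
        obtain ⟨E', f, hf, hTf⟩ := hTE {g}
        refine ⟨c, (vanishing (({g} : Finset G) : Set G)).comap T, ⟨E', f.ker, ?_, fun x => ?_⟩, ?_⟩
        · refine isClosed_comap hf (C := ⊥) ?_
          rw [Subgroup.coe_bot]
          exact hV.isClosed_singleton 1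
        · rw [MonoidHom.mem_ker, ← hTf, Subgroup.mem_comap, mem_vanishing, funext_iff,
            Subtype.forall]
          rfl
        · ext x
          simp [mem_vanishing, ← hc g (by simp), inv_mul_eq_one, eq_comm (a := y g)])
      (by
        intro W _ hXW t ht htf
        lift t to Finset (Set (G → Points U)) using htf
        classical
        rw [← Set.image_univ] at ht
        obtain ⟨E, -, rfl⟩ := Finset.subset_set_image_iff.mp ht
        obtain ⟨x, hx, hxy⟩ := hyE E
        refine ⟨x, hXW hx, ?_⟩
        rw [Finset.coe_image]
        rintro _ ⟨g, hg, rfl⟩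
        exact (hxy g hg).symm)
    exact ⟨x, hxX, funext fun g => hx _ ⟨g, rfl⟩⟩
  · obtain ⟨E', f, hf, hTf⟩ := hTE E
    have : (X.map T).map (restrictHom _ E) = (X.map (restrictHom _ E')).map f := by
      rw [Subgroup.map_map, Subgroup.map_map]
      congr 1
      exact MonoidHom.ext hTf
    rw [this]
    exact hf.isClosed_map hU hV (hXE E')
  · rintro g _ ⟨x, hx, rfl⟩
    exact ⟨_, hinv g x hx, hT g x⟩

end Algebraic

end AlgShift

theorem theoremc {G : Type v} [Group G] (hG : AlgShift.IsPolycyclicByFinite G)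
    {K : Type u} [Field K] [IsAlgClosed K]
    (U V : Over (Spec (.of K))) [GrpObj U] [GrpObj V]
    (hU : AlgShift.IsAlgVariety U) (hV : AlgShift.IsAlgVariety V)
    (S₁ : Set (G → AlgShift.Points U)) (S₂ : Set (G → AlgShift.Points V))
    (h₁ : AlgShift.IsAlgGroupSubshift U S₁) (h₂ : AlgShift.IsAlgGroupSubshift V S₂)
    (τ : (G → AlgShift.Points U) → (G → AlgShift.Points V))
    (hτ : AlgShift.IsAlgGroupCA U V τ) :
    AlgShift.IsAlgGroupSFT U (τ ⁻¹' S₂) ∧ AlgShift.IsAlgGroupSFT V (τ '' S₁) :=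
  ⟨AlgShift.isAlgGroupSFT_preimage (h₂.isAlgGroupSFT hG hV.isFiniteType) hτ,
    AlgShift.isAlgGroupSFT_image hG hU.isFiniteType hV.isFiniteType h₁ hτ⟩
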